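/- Let $V$ be a finite set of players and let $\mathcal{G}=(V,E)$ be a directed graph without loops and without repeated edges (edges in both directions between two vertices are allowed) such that for every $i\in V$ the set of out-neighbors $N_i^+=\{j:(i,j)\in E\}$ is non-empty. Let $\mu$ be a probability distribution on $V$. In the deterministic buck-passing game each player $i$ chooses an element $s_i$ of $\mathcal{S}_i=N_i^+$. At time $0$ the buck is given to a vertex $X_0$ drawn from $\mu$, and $X_{t+1}=s_{X_t}$ for all $t\ge 0$. In the stochastic buck-passing game each player $i$ chooses an element $\pi_i$ of the set $\Sigma_i$ of probability distributions on $V$ that vanish outside $N_i^+$, and $(X_t)_{t\ge 0}$ is the time-homogeneous Markov chain with initial distribution $\mu$ and transition probabilities $\mathbb{P}(X_{t+1}=j\mid X_t=i)=\pi_i(j)$. In both games the cost of player $i$ is $$c_i=\mathbb{E}\Big[\lim_{T\to\infty}\frac1T\sum_{t=1}^{T}\mathbf{1}_{\{X_t=i\}}\Big].$$ A strategy profile is a Nash equilibrium if no player can strictly decrease her own cost by changing only her own strategy. Let $\mathrm{NE}(\mathcal{S})$ be the set of Nash equilibria (in pure strategies) of the deterministic game and $\mathrm{NE}(\Sigma)$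 the set of Nash equilibria of the stochastic game. Identify a deterministic profile $s=(s_i)_{i\in V}$ with the stochastic profile $(\delta_{s_i})_{i\in V}$ of point masses. Then for every buck-passing game, i.e. for all $\mathcal{G}$ and $\mu$ as above, $\mathrm{NE}(\mathcal{S})\subseteq\mathrm{NE}(\Sigma)$. -/

import Mathlib

open MeasureTheory ProbabilityTheory Filter

/-- A Nash equilibrium of a cost game with player set `V`, strategy sets `S i` and costs `c i`:
no player `i` has a profitable deviation, that is, a profile `s'` which differs from `s` at most in
coordinate `i` and has a strictly smaller cost for `i`. -/
def IsNashEquilibrium {V : Type*} {S : V → Type*} (c : V → (∀ i, S i) → ℝ) (s : ∀ i, S i) : Prop :=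
  ∀ (i : V) (s' : ∀ i, S i), (∀ j, j ≠ i → s' j = s j) → ¬ c i s' < c i s

/-- The asymptotic frequency of the vertex `i` along the sequence `x` of vertices,
`lim_{T → ∞} (1 / T) ∑_{t = 1}^{T} 1_{x t = i}`. -/
noncomputable def asymptoticFrequency {V : Type*} (i : V) (x : ℕ → V) : ℝ :=
  limUnder atTop fun T : ℕ =>
    (1 / (T : ℝ)) * ∑ t ∈ Finset.Icc 1 T, Set.indicator {i} (fun _ => (1 : ℝ)) (x t)

/-- A buck-passing game with player set `V`: a directed graph without loops (there is at most one
edge from a vertex to another, since edges form a relation), all of whose vertices have an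
out-neighbor, and a probability distribution of the initial holder of the buck. -/
structure BuckPassingGame (V : Type*) where
  graph : Digraph V
  loopless : ∀ i, ¬ graph.Adj i i
  exists_adj : ∀ i, ∃ j, graph.Adj i j
  init : PMF V

namespace BuckPassingGame

/-- In the deterministic game player `i` chooses an out-neighbor. -/
abbrev DetStrategy {V : Type*} (Γ : BuckPassingGame V) (i : V) : Type _ :=
  {j : V // Γ.graph.Adj i j}

/-- In the stochastic game player `i` chooses a probability distribution which vanishes outside of
the set of her out-neighbors. -/
abbrev StochStrategy {V : Type*} (Γ : BuckPassingGame V) (i : V) : Type _ :=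
  {p : PMF V // ∀ j, ¬ Γ.graph.Adj i j → p j = 0}

/-- The position of the buck at time `t` if `i₀` has it at time `0` and every player passes it
according to the deterministic profile `s`. -/
def detPosition {V : Type*} (Γ : BuckPassingGame V) (s : ∀ i, Γ.DetStrategy i) (i₀ : V) :
    ℕ → V
  | 0 => i₀
  | t + 1 => (s (Γ.detPosition s i₀ t)).1

/-- The cost of player `i` in the deterministic game: the expectation, over the initial holder, of
the asymptotic frequency of times at which `i` has the buck. -/
noncomputable def detCost {V : Type*} [MeasurableSpace V]
    (Γ : BuckPassingGame V) (i : V) (s : ∀ i, Γ.DetStrategy i) : ℝ :=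
  ∫ i₀, asymptoticFrequency i (Γ.detPosition s i₀) ∂Γ.init.toMeasure

/-- The transition kernel of the profile `π`: the buck moves from `i` to a vertex drawn
from `π i`. -/
noncomputable def transition {V : Type*} [Countable V] [MeasurableSpace V]
    [MeasurableSingletonClass V] (Γ : BuckPassingGame V) (π : ∀ i, Γ.StochStrategy i) :
    Kernel V V :=
  Kernel.ofFunOfCountable fun i => (π i).1.toMeasure

instance {V : Type*} [Countable V] [MeasurableSpace V] [MeasurableSingletonClass V]
    (Γ : BuckPassingGame V) (π : ∀ i, Γ.StochStrategy i) : IsMarkovKernel (Γ.transition π) :=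
  ⟨fun i => inferInstanceAs (IsProbabilityMeasure (π i).1.toMeasure)⟩

/-- The law on the space of trajectories `ℕ → V` of the time-homogeneous Markov chain with initial
distribution `Γ.init` and transition kernel `Γ.transition π`: given the positions at the times
`0, …, n`, the position at time `n + 1` is drawn from the transition kernel at the position at
time `n`. -/
noncomputable def chainLaw {V : Type*} [Countable V] [MeasurableSpace V]
    [MeasurableSingletonClass V] (Γ : BuckPassingGame V) (π : ∀ i, Γ.StochStrategy i) :
    Measure (ℕ → V) :=
  Kernel.trajMeasure (X := fun _ => V) Γ.init.toMeasure fun n =>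
    (Γ.transition π).comap (fun h : (Finset.Iic n → V) => h ⟨n, Finset.mem_Iic.2 le_rfl⟩)
      (measurable_pi_apply _)

/-- The cost of player `i` in the stochastic game: the expected asymptotic frequency of times at
which `i` has the buck. -/
noncomputable def stochCost {V : Type*} [Countable V] [MeasurableSpace V]
    [MeasurableSingletonClass V] (Γ : BuckPassingGame V) (i : V)
    (π : ∀ i, Γ.StochStrategy i) : ℝ :=
  ∫ x, asymptoticFrequency i x ∂Γ.chainLaw π

/-- The Nash equilibria (in pure strategies) of the deterministic game. -/
def detNash {V : Type*} [MeasurableSpace V] (Γ : BuckPassingGame V) :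
    Set (∀ i, Γ.DetStrategy i) :=
  {s | IsNashEquilibrium Γ.detCost s}

/-- The Nash equilibria of the stochastic game. -/
def stochNash {V : Type*} [Countable V] [MeasurableSpace V] [MeasurableSingletonClass V]
    (Γ : BuckPassingGame V) : Set (∀ i, Γ.StochStrategy i) :=
  {π | IsNashEquilibrium Γ.stochCost π}

/-- A deterministic profile as a stochastic one: player `i` chooses the out-neighbor `s i` with
probability one. -/
noncomputable def detToStoch {V : Type*} (Γ : BuckPassingGame V) (s : ∀ i, Γ.DetStrategy i) :
    ∀ i, Γ.StochStrategy i :=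
  fun i => ⟨PMF.pure (s i).1, fun _ hj =>
    PMF.pure_apply_of_ne _ _ fun h => hj (h ▸ (s i).2)⟩

end BuckPassingGame

/-! Fix player `i`, let the others follow `σ`, and let `i` draw from `p`. Only starts in the basin
of `i` matter. If `p` charges a vertex outside the basin, the buck visits `i` with frequency zero.
Otherwise each return takes on average `1 + a` steps, where `a` is the `p`-mean of the hitting time
of `i`. So the cost is the initial mass of the basin times `returnFrequency σ i p`, in the
deterministic game too (`stochCost_eq`, `detCost_eq`). A mean is at most the maximum over the
support, so a mixture does no better than the best pure move it charges (`returnFrequency_pure_le`).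

The frequency is found without renewal theory: by a strong law, the averaged drift of a function on
`V` tends to zero along almost every trajectory, and a suitable `potential` has a drift that counts
the visits to `i` (`tendsto_visits`). -/

open scoped Topology

/-! ### A strong law for orthogonal increments -/

/-- A strong law of large numbers: bounded random variables, each of which is orthogonal to the sum
of the preceding ones, have averages which tend to zero almost surely. -/
theorem ae_tendsto_average_zero_of_orthogonal {Ω : Type*} [MeasurableSpace Ω] {P : Measure Ω}
    [IsProbabilityMeasure P] {D : ℕ → Ω → ℝ} {C : ℝ} (hD : ∀ t, Measurable (D t))
    (hC : ∀ t ω, |D t ω| ≤ C)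
    (horth : ∀ T, ∫ ω, (∑ t ∈ Finset.range T, D t ω) * D T ω ∂P = 0) :
    ∀ᵐ ω ∂P, Tendsto (fun T : ℕ => (∑ t ∈ Finset.range T, D t ω) / T) atTop (𝓝 0) := by
  have hC0 : 0 ≤ C := by
    obtain ⟨ω⟩ := nonempty_of_isProbabilityMeasure P
    exact (abs_nonneg _).trans (hC 0 ω)
  set M : ℕ → Ω → ℝ := fun T ω => ∑ t ∈ Finset.range T, D t ω with hM
  have hMm : ∀ T, Measurable (M T) := fun T => by
    simp only [hM]; fun_prop
  have hMC : ∀ T ω, |M T ω| ≤ T * C := fun T ω => by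
    refine (Finset.abs_sum_le_sum_abs _ _).trans ((Finset.sum_le_sum fun t _ => hC t ω).trans ?_)
    simp
  have hint : ∀ {g : Ω → ℝ} (B : ℝ), Measurable g → (∀ ω, |g ω| ≤ B) → Integrable g P :=
    fun B hg hB => Integrable.of_bound hg.aestronglyMeasurable B (ae_of_all _ hB)
  have hMM : ∀ T, Integrable (fun ω => M T ω ^ 2) P := fun T =>
    hint ((T * C) ^ 2) ((hMm T).pow_const 2) fun ω => by
      rw [abs_pow]; exact pow_le_pow_left₀ (abs_nonneg _) (hMC T ω) 2
  have hDD : ∀ T, Integrable (fun ω => D T ω ^ 2) P := fun T =>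
    hint (C ^ 2) ((hD T).pow_const 2) fun ω => by
      rw [abs_pow]; exact pow_le_pow_left₀ (abs_nonneg _) (hC T ω) 2
  have hMD : ∀ T, Integrable (fun ω => M T ω * D T ω) P := fun T =>
    hint (T * C * C) ((hMm T).mul (hD T)) fun ω => by
      rw [abs_mul]
      exact mul_le_mul (hMC T ω) (hC T ω) (abs_nonneg _) (by positivity)
  have hvar : ∀ T : ℕ, ∫ ω, M T ω ^ 2 ∂P ≤ T * C ^ 2 := by
    intro T
    induction T with
    | zero => simp [hM]
    | succ T ih =>
      have h1 : ∀ ω, M (T + 1) ω ^ 2 = M T ω ^ 2 + 2 * (M T ω * D T ω) + D T ω ^ 2 := fun ω => by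
        simp only [hM, Finset.sum_range_succ]; ring
      have h2 : ∫ ω, D T ω ^ 2 ∂P ≤ C ^ 2 := by
        calc ∫ ω, D T ω ^ 2 ∂P ≤ ∫ _, C ^ 2 ∂P :=
              integral_mono (hDD T) (integrable_const _) fun ω => by
                simpa using pow_le_pow_left₀ (abs_nonneg _) (hC T ω) 2
          _ = C ^ 2 := by simp
      simp_rw [h1]
      rw [integral_add (f := fun ω => M T ω ^ 2 + 2 * (M T ω * D T ω))
          ((hMM T).add ((hMD T).const_mul 2)) (hDD T),
        integral_add (hMM T) ((hMD T).const_mul 2), integral_const_mul, horth T]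
      push_cast
      linarith
  -- Along the squares the second moments are at most `C ^ 2 / n ^ 2`, hence summable; so the sum of
  -- the squared averages is almost surely finite.
  have hsq : ∀ᵐ ω ∂P, Tendsto (fun n : ℕ => (M (n ^ 2) ω / (n : ℝ) ^ 2) ^ 2) atTop (𝓝 0) := by
    have hfin : ∫⁻ ω, ∑' n : ℕ, ENNReal.ofReal ((M (n ^ 2) ω / (n : ℝ) ^ 2) ^ 2) ∂P ≠ ⊤ := by
      rw [lintegral_tsum fun n => by
        exact (((hMm (n ^ 2)).div_const _).pow_const 2).ennreal_ofReal.aemeasurable]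
      have hs : Summable fun n : ℕ => C ^ 2 * (1 / (n : ℝ) ^ 2) :=
        (Real.summable_one_div_nat_pow.2 one_lt_two).mul_left _
      refine ne_top_of_le_ne_top hs.tsum_ofReal_ne_top (ENNReal.tsum_le_tsum fun n => ?_)
      simp_rw [div_pow]
      rw [← ofReal_integral_eq_lintegral_ofReal ((hMM _).div_const _)
        (ae_of_all _ fun ω => by positivity), integral_div]
      refine ENNReal.ofReal_le_ofReal ?_
      rcases Nat.eq_zero_or_pos n with rfl | hn
      · simp
      · have hn' : (0 : ℝ) < n := by exact_mod_cast hn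
        rw [div_le_iff₀ (by positivity)]
        refine (hvar _).trans (le_of_eq ?_)
        push_cast
        field_simp
    filter_upwards [ae_lt_top' (AEMeasurable.tsum fun n =>
      (((hMm (n ^ 2)).div_const _).pow_const 2).ennreal_ofReal.aemeasurable) hfin] with ω hω
    have h := (ENNReal.tendsto_toReal ENNReal.zero_ne_top).comp
      (ENNReal.tendsto_atTop_zero_of_tsum_ne_top hω.ne)
    simpa [Function.comp_def, ENNReal.toReal_ofReal, sq_nonneg] using h
  filter_upwards [hsq] with ω hω
  have habs : Tendsto (fun n : ℕ => |M (n ^ 2) ω| / (n : ℝ) ^ 2 + 2 * C / n) atTop (𝓝 0) := by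
    have h1 := (Real.continuous_sqrt.tendsto 0).comp hω
    have h2 : Tendsto (fun n : ℕ => 2 * C / (n : ℝ)) atTop (𝓝 0) :=
      tendsto_const_div_atTop_nhds_zero_nat _
    simpa [Function.comp_def, Real.sqrt_sq_eq_abs, abs_div] using h1.add h2
  have hsqrt : Tendsto Nat.sqrt atTop atTop :=
    tendsto_atTop_atTop.2 fun b => ⟨b * b, fun a ha => Nat.le_sqrt.2 ha⟩
  refine squeeze_zero_norm' ?_ (habs.comp hsqrt)
  filter_upwards [eventually_ge_atTop 1] with T hT
  have hn : 0 < Nat.sqrt T := Nat.sqrt_pos.2 hT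
  have hn1 : Nat.sqrt T ^ 2 ≤ T := Nat.sqrt_le' T
  have hn2 : T ≤ Nat.sqrt T ^ 2 + 2 * Nat.sqrt T := by
    have := Nat.sqrt_le_add T; nlinarith
  simp only [Function.comp_apply]
  generalize Nat.sqrt T = n at hn hn1 hn2 ⊢
  have hn' : (0 : ℝ) < n := by exact_mod_cast hn
  have hn1' : (n : ℝ) ^ 2 ≤ T := by exact_mod_cast hn1
  have hn2' : (T : ℝ) ≤ n ^ 2 + 2 * n := by exact_mod_cast hn2
  -- At most `2 * n` terms separate `T` from the largest square below it, which is negligible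
  -- against `n ^ 2`.
  have hdiff : |M T ω| ≤ |M (n ^ 2) ω| + 2 * n * C := by
    have h1 : M T ω = M (n ^ 2) ω + ∑ t ∈ Finset.Ico (n ^ 2) T, D t ω := by
      simp only [hM]
      rw [Finset.sum_range_add_sum_Ico _ hn1]
    have h2 : |∑ t ∈ Finset.Ico (n ^ 2) T, D t ω| ≤ (T - n ^ 2 : ℝ) * C := by
      refine (Finset.abs_sum_le_sum_abs _ _).trans
        ((Finset.sum_le_sum fun t _ => hC t ω).trans (le_of_eq ?_))
      simp [Nat.cast_sub hn1]
    rw [h1]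
    refine (abs_add_le _ _).trans (add_le_add le_rfl (h2.trans ?_))
    exact mul_le_mul_of_nonneg_right (by linarith) hC0
  rw [Real.norm_eq_abs, abs_div, Nat.abs_cast]
  calc |M T ω| / T ≤ (|M (n ^ 2) ω| + 2 * n * C) / (n : ℝ) ^ 2 := by
        gcongr
    _ = |M (n ^ 2) ω| / (n : ℝ) ^ 2 + 2 * C / n := by
        field_simp

theorem PMF.ae_ne_zero {V : Type*} [Countable V] [MeasurableSpace V] [MeasurableSingletonClass V]
    (p : PMF V) : ∀ᵐ v ∂p.toMeasure, p v ≠ 0 := by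
  rw [ae_iff, PMF.toMeasure_apply_eq_zero_iff _ (Set.to_countable _).measurableSet]
  exact Set.disjoint_left.2 fun v hv h => h hv

/-! ### The law of the trajectory -/

namespace BuckPassingGame

variable {V : Type*} [Finite V] [MeasurableSpace V] [DiscreteMeasurableSpace V]

instance (Γ : BuckPassingGame V) (π : ∀ i, Γ.StochStrategy i) :
    IsProbabilityMeasure (Γ.chainLaw π) := by
  unfold chainLaw; infer_instance

theorem map_eval_zero_chainLaw (Γ : BuckPassingGame V) (π : ∀ i, Γ.StochStrategy i) :
    (Γ.chainLaw π).map (fun x => x 0) = Γ.init.toMeasure := by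
  have h : (fun x : ℕ → V => x 0) =
      (fun y : Finset.Iic 0 → V => y ⟨0, by simp⟩) ∘ Preorder.frestrictLe (π := fun _ => V) 0 := rfl
  rw [h, ← Measure.map_map (by fun_prop) (by fun_prop), chainLaw, Kernel.trajMeasure,
    Measure.map_comp _ _ (by fun_prop), Kernel.traj_map_frestrictLe, Kernel.partialTraj_self,
    Measure.id_comp, Measure.map_map (by fun_prop) (by fun_prop)]
  exact Measure.map_id

/-- The Markov property in integrated form: the next position is averaged out given the history. -/
theorem integral_chainLaw_step (Γ : BuckPassingGame V) (π : ∀ i, Γ.StochStrategy i) (t : ℕ)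
    (F : (Finset.Iic t → V) → V → ℝ) :
    ∫ x, F (Preorder.frestrictLe (π := fun _ => V) t x) (x (t + 1)) ∂Γ.chainLaw π =
      ∫ x, ∫ v, F (Preorder.frestrictLe (π := fun _ => V) t x) v ∂(π (x t)).1.toMeasure
        ∂Γ.chainLaw π := by
  have h := Kernel.map_frestrictLe_trajMeasure_compProd_eq_map_trajMeasure
    (X := fun _ => V) (μ₀ := Γ.init.toMeasure) (a := t)
    (κ := fun n => (Γ.transition π).comap
      (fun h : (Finset.Iic n → V) => h ⟨n, Finset.mem_Iic.2 le_rfl⟩) (measurable_pi_apply _))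
  change (Γ.chainLaw π).map _ ⊗ₘ _ = (Γ.chainLaw π).map _ at h
  have h2 := congrArg (fun ν => ∫ z, F z.1 z.2 ∂ν) h
  rw [integral_map (by fun_prop) (by
    exact (measurable_of_countable _).aestronglyMeasurable)] at h2
  rw [← h2, Measure.integral_compProd Integrable.of_finite, integral_map (by fun_prop) (by
    exact (measurable_of_countable _).aestronglyMeasurable)]
  rfl

theorem ae_transition_ne_zero (Γ : BuckPassingGame V) (π : ∀ i, Γ.StochStrategy i) :
    ∀ᵐ x ∂Γ.chainLaw π, ∀ t, (π (x t)).1 (x (t + 1)) ≠ 0 := by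
  classical
  rw [ae_all_iff]
  intro t
  set g : V → V → ℝ := fun w v => if (π w).1 v = 0 then 1 else 0 with hg
  have hg0 : ∀ w v, 0 ≤ g w v := fun w v => by simp only [hg]; split_ifs <;> simp
  have h : ∫ x, g (x t) (x (t + 1)) ∂Γ.chainLaw π =
      ∫ x, ∫ v, g (x t) v ∂(π (x t)).1.toMeasure ∂Γ.chainLaw π :=
    Γ.integral_chainLaw_step π t fun y => g (y ⟨t, by simp⟩)
  have h0 : ∀ w : V, ∫ v, g w v ∂(π w).1.toMeasure = 0 := by
    intro w
    refine integral_eq_zero_of_ae ?_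
    filter_upwards [(π w).1.ae_ne_zero] with v hv
    simp [hg, hv]
  simp only [h0, integral_zero] at h
  rw [integral_eq_zero_iff_of_nonneg (fun x => hg0 _ _)] at h
  · filter_upwards [h] with x hx hx0
    simp [hg, hx0] at hx
  · refine Integrable.of_bound (C := 1) ?_
      (ae_of_all _ fun x => by simp only [hg]; split_ifs <;> simp)
    have hm : Measurable fun z : V × V => g z.1 z.2 := measurable_of_countable _
    have hp : Measurable fun x : ℕ → V => (x t, x (t + 1)) := by fun_prop
    exact (hm.comp hp).aestronglyMeasurable

end BuckPassingGame

/-! ### Centered increments and drift -/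

namespace BuckPassingGame

/-- The averages of the increments of `f` along the trajectory `x`, centered by their conditional
expectations under the transition probabilities `K`, tend to zero. -/
def HasCenteredAverages {V : Type*} [MeasurableSpace V] (K : V → PMF V) (f : V → ℝ) (x : ℕ → V) : Prop :=
  Tendsto (fun T : ℕ =>
    (∑ t ∈ Finset.range T, (f (x (t + 1)) - ∫ v, f v ∂(K (x t)).toMeasure)) / T) atTop (𝓝 0)

/-- The increments of `f` telescope to a bounded quantity, so their averages vanish, and the drift
is increment minus centered increment. -/
theorem HasCenteredAverages.tendsto_average_drift {V : Type*} [Finite V] [MeasurableSpace V]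
    {K : V → PMF V} {f : V → ℝ} {x : ℕ → V}
    (h : HasCenteredAverages K f x) :
    Tendsto (fun T : ℕ =>
      (∑ t ∈ Finset.range T, (∫ v, f v ∂(K (x t)).toMeasure - f (x t))) / T) atTop (𝓝 0) := by
  obtain ⟨B, hB⟩ := (Set.finite_range fun v => |f v|).bddAbove
  have hB : ∀ v, |f v| ≤ B := fun v => hB ⟨v, rfl⟩
  have h1 : Tendsto (fun T : ℕ => (f (x T) - f (x 0)) / T) atTop (𝓝 0) := by
    refine squeeze_zero_norm (fun T => ?_) (tendsto_const_div_atTop_nhds_zero_nat (B + B))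
    rw [Real.norm_eq_abs, abs_div, Nat.abs_cast]
    gcongr
    exact (abs_sub _ _).trans (add_le_add (hB _) (hB _))
  have h2 := h1.sub h
  rw [sub_zero] at h2
  refine h2.congr fun T => ?_
  rw [← sub_div, ← Finset.sum_range_sub (fun t => f (x t)), ← Finset.sum_sub_distrib]
  congr 1
  exact Finset.sum_congr rfl fun t _ => by ring

variable {V : Type*} [Finite V] [MeasurableSpace V] [DiscreteMeasurableSpace V]

/-- The centered increment of `f` at time `t` is orthogonal to the functions of the trajectory up to
time `t`. -/
theorem integral_mul_centered_increment (Γ : BuckPassingGame V) (π : ∀ i, Γ.StochStrategy i) (t : ℕ)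
    (G : (Finset.Iic t → V) → ℝ) (f : V → ℝ) :
    ∫ x, G (Preorder.frestrictLe (π := fun _ => V) t x) *
      (f (x (t + 1)) - ∫ v, f v ∂(π (x t)).1.toMeasure) ∂Γ.chainLaw π = 0 := by
  refine (Γ.integral_chainLaw_step π t fun y v =>
    G y * (f v - ∫ v, f v ∂(π (y ⟨t, by simp⟩)).1.toMeasure)).trans ?_
  refine integral_eq_zero_of_ae (ae_of_all _ fun x => ?_)
  simp only [Pi.zero_apply, Preorder.frestrictLe_apply]
  rw [integral_const_mul, integral_sub Integrable.of_finite Integrable.of_finite]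
  simp

theorem ae_hasCenteredAverages (Γ : BuckPassingGame V) (π : ∀ i, Γ.StochStrategy i) (f : V → ℝ) :
    ∀ᵐ x ∂Γ.chainLaw π, HasCenteredAverages (fun i => (π i).1) f x := by
  obtain ⟨B, hB⟩ : ∃ B, ∀ v, |f v| ≤ B := by
    obtain ⟨B, hB⟩ := (Set.finite_range fun v => |f v|).bddAbove
    exact ⟨B, fun v => hB ⟨v, rfl⟩⟩
  obtain ⟨m, hm⟩ : ∃ m : V → ℝ, ∀ w, m w = ∫ v, f v ∂(π w).1.toMeasure := ⟨_, fun _ => rfl⟩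
  have hmB : ∀ w, |m w| ≤ B := fun w => by
    rw [hm]
    simpa using norm_integral_le_of_norm_le_const (μ := (π w).1.toMeasure) (f := f) (ae_of_all _ hB)
  have hmeas : ∀ g : V → ℝ, Measurable g := fun g => measurable_of_countable g
  simp only [HasCenteredAverages, ← hm]
  have heval : ∀ t, Measurable fun x : ℕ → V => x t := fun t => measurable_pi_apply t
  refine ae_tendsto_average_zero_of_orthogonal (P := Γ.chainLaw π)
    (D := fun t x => f (x (t + 1)) - m (x t)) (C := B + B)
    (fun t => ((hmeas f).comp (heval (t + 1))).sub ((hmeas m).comp (heval t))) (fun t x => (abs_sub _ _).trans (add_le_add (hB _) (hmB _)))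
    (fun T => ?_)
  -- Freezing the history after time `T` exhibits the preceding partial sum, which only involves
  -- times up to `T`, as a function of that history.
  let e : (Finset.Iic T → V) → ℕ → V := fun y t =>
    if h : t ≤ T then y ⟨t, Finset.mem_Iic.2 h⟩ else y ⟨T, by simp⟩
  have he : ∀ x : ℕ → V, ∀ t ≤ T, e (Preorder.frestrictLe (π := fun _ => V) T x) t = x t :=
    fun x t ht => by simp [e, ht]
  have h := Γ.integral_mul_centered_increment π T
    (fun y => ∑ t ∈ Finset.range T, (f (e y (t + 1)) - m (e y t))) f
  rw [← h]
  refine integral_congr_ae (ae_of_all _ fun x => ?_)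
  dsimp only
  rw [hm (x T)]
  congr 1
  refine Finset.sum_congr rfl fun t ht => ?_
  rw [he x _ (Finset.mem_range.1 ht), he x _ (Finset.mem_range.1 ht).le]

/-! ### Hitting times and the frequency of visits -/

/-- The number of steps which the iteration of `σ` needs to reach `i`, and zero if it never does. -/
noncomputable def hittingTime {V : Type*} (σ : V → V) (i v : V) : ℕ := sInf {n | σ^[n] v = i}

/-- The set of vertices from which the iteration of `σ` reaches `i`. -/
def basin {V : Type*} (σ : V → V) (i : V) : Set V := {v | ∃ n, σ^[n] v = i}

theorem self_mem_basin {V : Type*} (σ : V → V) (i : V) : i ∈ basin σ i := ⟨0, rfl⟩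

theorem hittingTime_self {V : Type*} (σ : V → V) (i : V) : hittingTime σ i i = 0 :=
  Nat.sInf_eq_zero.2 (Or.inl rfl)

theorem hittingTime_of_notMem {V : Type*} {σ : V → V} {i v : V} (h : v ∉ basin σ i) :
    hittingTime σ i v = 0 :=
  Nat.sInf_eq_zero.2 (Or.inr (Set.eq_empty_of_forall_notMem fun n hn => h ⟨n, hn⟩))

theorem map_mem_basin_iff {V : Type*} {σ : V → V} {i v : V} (hv : v ≠ i) :
    σ v ∈ basin σ i ↔ v ∈ basin σ i := by
  constructor
  · rintro ⟨n, hn⟩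
    exact ⟨n + 1, hn⟩
  · rintro ⟨_ | n, hn⟩
    · exact absurd hn hv
    · exact ⟨n, hn⟩

theorem hittingTime_eq_map_add_one {V : Type*} {σ : V → V} {i v : V} (hv : v ≠ i)
    (h : v ∈ basin σ i) : hittingTime σ i v = hittingTime σ i (σ v) + 1 := by
  have h1 : σ^[hittingTime σ i v] v = i := Nat.sInf_mem h
  have h2 : σ^[hittingTime σ i (σ v)] (σ v) = i := Nat.sInf_mem ((map_mem_basin_iff hv).2 h)
  refine le_antisymm (Nat.sInf_le h2) ?_
  rcases hn : hittingTime σ i v with _ | n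
  · rw [hn] at h1; exact absurd h1 hv
  · rw [hn] at h1
    exact Nat.succ_le_succ (Nat.sInf_le h1)

open Classical in
/-- The asymptotic frequency of the visits to `i`, starting from `i`, if the buck moves from `i` to
a vertex drawn from `p` and from the other vertices according to `σ`. -/
noncomputable def returnFrequency (σ : V → V) (i : V) (p : PMF V) : ℝ :=
  if ∃ j, p j ≠ 0 ∧ j ∉ basin σ i then 0
  else (1 + ∫ v, (hittingTime σ i v : ℝ) ∂p.toMeasure)⁻¹

open Classical in
/-- A function whose drift determines the asymptotic frequency of the visits to `i`. -/
noncomputable def potential (σ : V → V) (i : V) (p : PMF V) : V → ℝ :=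
  if ∃ j, p j ≠ 0 ∧ j ∉ basin σ i then (basin σ i).indicator 1
  else fun v => hittingTime σ i v

-- Off `i` the indicator of the basin has drift zero, and the hitting time has drift `-1` inside the
-- basin and zero outside. Either way the drift is, up to a constant along the trajectory, a nonzero
-- multiple of the indicator of `i`.
open Classical in
theorem tendsto_visits {σ : V → V} {i : V} {K : V → PMF V} {x : ℕ → V}
    (hK : ∀ v, v ≠ i → K v = PMF.pure (σ v)) (hx : ∀ t, K (x t) (x (t + 1)) ≠ 0)
    (havg : HasCenteredAverages K (potential σ i (K i)) x) :
    Tendsto (fun T : ℕ => (∑ t ∈ Finset.range T, Set.indicator {i} (fun _ => (1 : ℝ)) (x t)) / T)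
      atTop (𝓝 (if x 0 ∈ basin σ i then returnFrequency σ i (K i) else 0)) := by
  have hdrift := havg.tendsto_average_drift
  have hoff : ∀ (f : V → ℝ) (v : V), v ≠ i → ∫ w, f w ∂(K v).toMeasure = f (σ v) := fun f v hv => by
    rw [hK v hv, PMF.toMeasure_pure, integral_dirac]
  by_cases hq : ∃ j, K i j ≠ 0 ∧ j ∉ basin σ i
  · simp only [returnFrequency, potential, if_pos hq, ite_self] at hdrift ⊢
    set f : V → ℝ := (basin σ i).indicator 1 with hf
    have hf1 : ∀ v, f v ≤ 1 := fun v => Set.indicator_le_self' (by simp) v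
    set q : ℝ := ∫ w, f w ∂(K i).toMeasure with hqd
    -- The drift at `i` is `q - 1`, which is nonzero because `K i` charges a vertex outside the
    -- basin.
    have hq1 : q - 1 ≠ 0 := by
      intro h
      have h0 : ∫ w, (1 - f w) ∂(K i).toMeasure = 0 := by
        rw [integral_sub Integrable.of_finite Integrable.of_finite, ← hqd]
        simp; linarith
      rw [integral_eq_zero_iff_of_nonneg (fun v => sub_nonneg.2 (hf1 v)) Integrable.of_finite] at h0
      obtain ⟨j, hj, hjR⟩ := hq
      have h1 : (K i).toMeasure {j} = 0 := by
        refine measure_mono_null ?_ (ae_iff.1 h0)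
        rintro _ rfl
        simp [hf, hjR]
      rw [PMF.toMeasure_apply_singleton _ _ (measurableSet_singleton j)] at h1
      exact hj h1
    have h2 := hdrift.div_const (q - 1)
    rw [zero_div] at h2
    refine h2.congr fun T => ?_
    rw [div_right_comm, Finset.sum_div]
    congr 1
    refine Finset.sum_congr rfl fun t _ => ?_
    by_cases hxt : x t = i
    · rw [hxt, ← hqd]
      simp [hf, self_mem_basin, hq1]
    · rw [hoff f _ hxt]
      simp [hf, hxt, Set.indicator, map_mem_basin_iff hxt]
  · simp only [returnFrequency, potential, if_neg hq] at hdrift ⊢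
    push Not at hq
    -- Here the trajectory can neither leave nor enter the basin, so the correction `b` below is
    -- constant in time.
    have hR : ∀ t, x t ∈ basin σ i ↔ x 0 ∈ basin σ i := by
      intro t
      induction t with
      | zero => rfl
      | succ t ih =>
        rw [← ih]
        by_cases hxt : x t = i
        · have h1 := hx t
          rw [hxt] at h1 ⊢
          exact iff_of_true (hq _ h1) (self_mem_basin σ i)
        · have h1 := hx t
          rw [hK _ hxt] at h1
          rw [show x (t + 1) = σ (x t) by
            by_contra h
            exact h1 (PMF.pure_apply_of_ne _ _ h)]
          exact map_mem_basin_iff hxt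
    set a : ℝ := ∫ v, (hittingTime σ i v : ℝ) ∂(K i).toMeasure with ha
    have ha0 : 0 < 1 + a := by
      have : 0 ≤ a := integral_nonneg fun v => Nat.cast_nonneg _
      linarith
    set b : ℝ := if x 0 ∈ basin σ i then 1 else 0 with hb
    have h3 := (hdrift.add_const b).div_const (1 + a)
    have h4 : (0 + b) / (1 + a) = if x 0 ∈ basin σ i then (1 + a)⁻¹ else 0 := by
      simp only [hb]; split_ifs <;> simp
    rw [h4] at h3
    refine h3.congr' ?_
    filter_upwards [eventually_gt_atTop 0] with T hT
    have hT' : (T : ℝ) ≠ 0 := by exact_mod_cast hT.ne'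
    have h5 : ∑ t ∈ Finset.range T,
        (∫ v, (hittingTime σ i v : ℝ) ∂(K (x t)).toMeasure - (hittingTime σ i (x t) : ℝ)) =
        (1 + a) * (∑ t ∈ Finset.range T, Set.indicator {i} (fun _ => (1 : ℝ)) (x t)) - T * b := by
      have h6 : (T : ℝ) * b = ∑ t ∈ Finset.range T, b := by simp
      rw [h6, Finset.mul_sum, ← Finset.sum_sub_distrib]
      refine Finset.sum_congr rfl fun t _ => ?_
      by_cases hxt : x t = i
      · have hb1 : b = 1 := if_pos ((hR t).1 (hxt ▸ self_mem_basin σ i))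
        rw [hxt, ← ha, hb1, hittingTime_self]
        simp
      · rw [hoff (fun v => (hittingTime σ i v : ℝ)) _ hxt]
        by_cases hm : x t ∈ basin σ i
        · have hb1 : b = 1 := if_pos ((hR t).1 hm)
          rw [hb1, hittingTime_eq_map_add_one hxt hm]
          simp [hxt]
        · have hb0 : b = 0 := if_neg fun h => hm ((hR t).2 h)
          rw [hb0, hittingTime_of_notMem hm,
            hittingTime_of_notMem fun h => hm ((map_mem_basin_iff hxt).1 h)]
          simp [hxt]
    rw [h5]
    field_simp
    ring

theorem asymptoticFrequency_eq {σ : V → V} {i : V} {K : V → PMF V} {x : ℕ → V}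
    (hK : ∀ v, v ≠ i → K v = PMF.pure (σ v)) (hx : ∀ t, K (x t) (x (t + 1)) ≠ 0)
    (havg : HasCenteredAverages K (potential σ i (K i)) x) :
    asymptoticFrequency i x =
      (basin σ i).indicator (fun _ => returnFrequency σ i (K i)) (x 0) := by
  refine Tendsto.limUnder_eq ?_
  -- The cost counts times `1` to `T`, `tendsto_visits` counts `0` to `T - 1`; the difference is a
  -- bounded boundary term.
  have h1 : Tendsto (fun T : ℕ => (Set.indicator {i} (fun _ => (1 : ℝ)) (x T) -
      Set.indicator {i} (fun _ => (1 : ℝ)) (x 0)) / T) atTop (𝓝 0) := by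
    refine squeeze_zero_norm (fun T => ?_) (tendsto_const_div_atTop_nhds_zero_nat 1)
    rw [Real.norm_eq_abs, abs_div, Nat.abs_cast]
    gcongr
    by_cases h0 : x 0 = i <;> by_cases hT : x T = i <;> simp [h0, hT]
  have h2 := h1.add (tendsto_visits hK hx havg)
  rw [zero_add] at h2
  refine h2.congr fun T => ?_
  rw [← add_div, one_div, inv_mul_eq_div]
  congr 1
  rw [← Finset.sum_range_sub (fun t => Set.indicator {i} (fun _ => (1 : ℝ)) (x t)),
    ← Finset.sum_add_distrib, Finset.range_eq_Ico]
  simp only [sub_add_cancel]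
  rw [Finset.sum_Ico_add' (fun t => Set.indicator {i} (fun _ => (1 : ℝ)) (x t)) 0 T 1, zero_add,
    Finset.Ico_add_one_right_eq_Icc]

end BuckPassingGame

/-! ### Cost formulas and comparison of pure and mixed moves -/

namespace BuckPassingGame

theorem returnFrequency_nonneg {V : Type*} [MeasurableSpace V] (σ : V → V) (i : V)
    (p : PMF V) : 0 ≤ returnFrequency σ i p := by
  unfold returnFrequency
  split_ifs
  · rfl
  · have : 0 ≤ ∫ v, (hittingTime σ i v : ℝ) ∂p.toMeasure :=
      integral_nonneg fun v => Nat.cast_nonneg _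
    positivity

theorem returnFrequency_pure_of_notMem {V : Type*} [MeasurableSpace V] {σ : V → V} {i j : V}
    (hj : j ∉ basin σ i) :
    returnFrequency σ i (PMF.pure j) = 0 :=
  if_pos ⟨j, by simp, hj⟩

variable {V : Type*} [Finite V] [MeasurableSpace V] [DiscreteMeasurableSpace V]

theorem returnFrequency_pure_of_mem {σ : V → V} {i j : V} (hj : j ∈ basin σ i) :
    returnFrequency σ i (PMF.pure j) = (1 + (hittingTime σ i j : ℝ))⁻¹ := by
  rw [returnFrequency, if_neg, PMF.toMeasure_pure, integral_dirac]
  rintro ⟨k, hk, hkR⟩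
  have hkj : k ≠ j := by
    rintro rfl
    exact hkR hj
  exact hk (PMF.pure_apply_of_ne _ _ hkj)

/-- If no point mass at a possible value of `p` makes the visits to `i` less frequent than the point
mass at `j`, then neither does `p`. -/
theorem returnFrequency_pure_le {σ : V → V} {i j : V} {p : PMF V}
    (h : ∀ k, p k ≠ 0 → returnFrequency σ i (PMF.pure j) ≤ returnFrequency σ i (PMF.pure k)) :
    returnFrequency σ i (PMF.pure j) ≤ returnFrequency σ i p := by
  by_cases hj : j ∈ basin σ i
  · rw [returnFrequency_pure_of_mem hj] at h ⊢
    have hpos : (0 : ℝ) < (1 + (hittingTime σ i j : ℝ))⁻¹ := by positivity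
    have hk : ∀ k, p k ≠ 0 → k ∈ basin σ i := fun k hk => by
      by_contra hkR
      have := h k hk
      rw [returnFrequency_pure_of_notMem hkR] at this
      linarith
    have hle : ∀ k, p k ≠ 0 → (hittingTime σ i k : ℝ) ≤ hittingTime σ i j := fun k hpk => by
      have := h k hpk
      rw [returnFrequency_pure_of_mem (hk k hpk),
        inv_le_inv₀ (by positivity) (by positivity)] at this
      linarith
    rw [returnFrequency, if_neg (by push Not; exact hk)]
    have h0 : 0 ≤ ∫ v, (hittingTime σ i v : ℝ) ∂p.toMeasure :=
      integral_nonneg fun v => Nat.cast_nonneg _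
    have h1 : ∫ v, (hittingTime σ i v : ℝ) ∂p.toMeasure ≤ hittingTime σ i j := by
      calc ∫ v, (hittingTime σ i v : ℝ) ∂p.toMeasure
          ≤ ∫ _, (hittingTime σ i j : ℝ) ∂p.toMeasure :=
            integral_mono_ae Integrable.of_finite (integrable_const _) (by
              filter_upwards [p.ae_ne_zero] with v hv using hle v hv)
        _ = hittingTime σ i j := by simp
    gcongr
  · rw [returnFrequency_pure_of_notMem hj]
    exact returnFrequency_nonneg σ i p

theorem stochCost_eq (Γ : BuckPassingGame V) {σ : V → V} {i : V} {π : ∀ i, Γ.StochStrategy i}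
    (hπ : ∀ v, v ≠ i → (π v).1 = PMF.pure (σ v)) :
    Γ.stochCost i π = Γ.init.toMeasure.real (basin σ i) * returnFrequency σ i (π i).1 := by
  have h : ∀ᵐ x ∂Γ.chainLaw π, asymptoticFrequency i x =
      (basin σ i).indicator (fun _ => returnFrequency σ i (π i).1) (x 0) := by
    filter_upwards [Γ.ae_transition_ne_zero π,
      Γ.ae_hasCenteredAverages π (potential σ i (π i).1)] with x hx havg
    exact asymptoticFrequency_eq (K := fun v => (π v).1) hπ hx havg
  have heval : Measurable fun x : ℕ → V => x 0 := measurable_pi_apply 0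
  rw [stochCost, integral_congr_ae h, ← smul_eq_mul,
    ← integral_indicator_const _ (Set.to_countable _).measurableSet, ← Γ.map_eval_zero_chainLaw π,
    integral_map heval.aemeasurable (measurable_of_countable _).aestronglyMeasurable]

theorem detCost_eq (Γ : BuckPassingGame V) {σ : V → V} {i : V} {s : ∀ i, Γ.DetStrategy i}
    (hs : ∀ v, v ≠ i → (s v).1 = σ v) :
    Γ.detCost i s =
      Γ.init.toMeasure.real (basin σ i) * returnFrequency σ i (PMF.pure (s i).1) := by
  have h : ∀ v, asymptoticFrequency i (Γ.detPosition s v) =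
      (basin σ i).indicator (fun _ => returnFrequency σ i (PMF.pure (s i).1)) v := fun v => by
    refine asymptoticFrequency_eq (K := fun v => PMF.pure (s v).1) (x := Γ.detPosition s v)
      (fun w hw => by rw [hs w hw]) (fun t => by simp [detPosition]) ?_
    -- Along a deterministic orbit every centered increment is zero, so no strong law is needed.
    simp [HasCenteredAverages, PMF.toMeasure_pure, detPosition]
  simp_rw [detCost, h]
  rw [integral_indicator_const _ (Set.to_countable _).measurableSet, smul_eq_mul]

end BuckPassingGame

theorem mainTheorem6 {V : Type*} [Finite V] [MeasurableSpace V] [DiscreteMeasurableSpace V]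
    (Γ : BuckPassingGame V) :
    Γ.detToStoch '' Γ.detNash ⊆ Γ.stochNash := by
  classical
  rintro _ ⟨s, hs, rfl⟩ i π hπ
  -- The cost formulas need `σ` only off `i`, so the same `σ` and the same basin serve every
  -- deviation of `i`.
  rw [not_lt, Γ.stochCost_eq (σ := fun v => (s v).1) (i := i) fun v _ => rfl,
    Γ.stochCost_eq (σ := fun v => (s v).1) (i := i) fun v hv => by rw [hπ v hv]; rfl]
  -- If the basin has mass zero, all costs of `i` vanish; otherwise its mass can be cancelled in the
  -- deterministic equilibrium inequality.
  rcases (measureReal_nonneg (μ := Γ.init.toMeasure)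
    (s := BuckPassingGame.basin (fun v => (s v).1) i)).eq_or_lt with h0 | h0
  · rw [← h0, zero_mul, zero_mul]
  refine mul_le_mul_of_nonneg_left (BuckPassingGame.returnFrequency_pure_le fun k hk => ?_) h0.le
  have hadj : Γ.graph.Adj i k := by
    by_contra h
    exact hk ((π i).2 k h)
  have h1 := hs i (Function.update s i ⟨k, hadj⟩) fun j hj => Function.update_of_ne hj _ _
  rw [not_lt, Γ.detCost_eq (σ := fun v => (s v).1) fun v _ => rfl,
    Γ.detCost_eq (σ := fun v => (s v).1) fun v hv => by rw [Function.update_of_ne hv],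
    Function.update_self] at h1
  exact le_of_mul_le_mul_left h1 h0
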